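/- Let $V$ be a finite set of $n\ge 2$ vertices, let $E(K_n)$ be the edge set of the complete graph on $V$, and let $w:E(K_n)\to\mathbb{R}_{>0}$ and $p:E(K_n)\to[0,1]$. For a graph $G$ on $V$ put $t_w(G)=\sum_{T}\prod_{e\in E(T)}w(e)$, where $T$ ranges over the spanning trees of $G$. For $E\subseteq E(K_n)$ let $\mathbb{G}((V,E),p)$ be the random spanning subgraph of $(V,E)$ in which each edge $e\in E$ is present with probability $p(e)$, independently of the other edges, and define $$\xi(E)=\mathbb{E}_{G\sim\mathbb{G}((V,E),p)}\big[t_w(G)\big].$$ A function $f:2^{\mathcal W}\to\mathbb{R}$ on the subsets of a finite set $\mathcal W$ is called normalized if $f(\varnothing)=0$, monotone if $f(A)\le f(B)$ whenever $A\subseteq B\subseteq\mathcal W$, submodular if $f(A\cup\{s\})-f(A)\ge f(B\cup\{s\})-f(B)$ whenever $A\subseteq B\subseteq\mathcal W$ and $s\in\mathcal W\setminus B$, supermodular if $-f$ is submodular, and log-submodular if $f>0$ and $\log f$ is submodular. 1. The set function $\xi:2^{E(K_n)}\to\mathbb{R}$ is normalized, monotone and supermodular. 2. Let $E_{\mathrm{init}}\subseteq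 E(K_n)$ be such that the graph on $V$ with edge set $\{e\in E_{\mathrm{init}}: p(e)>0\}$ is connected (that is, $(V,E_{\mathrm{init}})$ is a connected base graph that remains connected when its edges of probability $0$ are discarded). Put $\ell(E)=\log\xi(E)$ if $\xi(E)>0$ and $\ell(E)=0$ otherwise. Then the logarithmic gain $E\mapsto \ell(E\cup E_{\mathrm{init}})-\ell(E_{\mathrm{init}})$ on $2^{E(K_n)}$ is normalized, monotone and submodular. Moreover, the function $E\mapsto\xi(E\cup E_{\mathrm{init}})$ is log-submodular (in particular positive). -/

import Mathlib

noncomputable section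

/-! ### Set functions on a finite ground set -/

/-- `ξ : 2^W → ℝ` is normalized if `ξ(∅) = 0`. -/
def IsNormalized {W : Type*} (ξ : Finset W → ℝ) : Prop := ξ ∅ = 0

/-- `ξ : 2^W → ℝ` is submodular if it has diminishing returns:
`ξ(A ∪ {s}) - ξ(A) ≥ ξ(B ∪ {s}) - ξ(B)` whenever `A ⊆ B ⊆ W` and `s ∈ W \ B`. -/
def IsSubmodular {W : Type*} [DecidableEq W] (ξ : Finset W → ℝ) : Prop :=
  ∀ A B : Finset W, A ⊆ B → ∀ s : W, s ∉ B →
    ξ (insert s B) - ξ B ≤ ξ (insert s A) - ξ A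

/-- `ξ` is supermodular if `-ξ` is submodular. -/
def IsSupermodular {W : Type*} [DecidableEq W] (ξ : Finset W → ℝ) : Prop :=
  IsSubmodular fun A => -ξ A

/-- `ξ` is log-submodular if it is positive and `log ξ` is submodular. -/
def IsLogSubmodular {W : Type*} [DecidableEq W] (ξ : Finset W → ℝ) : Prop :=
  (∀ A, 0 < ξ A) ∧ IsSubmodular fun A => Real.log (ξ A)

/-! ### Weighted number of spanning trees -/

/-- The edge set `E(K_n)` of the complete graph on the vertex set `V`, as a type. -/
abbrev KEdge (V : Type*) : Type _ := (⊤ : SimpleGraph V).edgeSet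

/-- The graph `(V, E)` for a set `E ⊆ E(K_n)`. -/
def graphOn {V : Type*} (E : Set (KEdge V)) : SimpleGraph V :=
  SimpleGraph.fromEdgeSet (Subtype.val '' E)

/-- The spanning trees of `G`: the spanning subgraphs of `G` that are trees. -/
def spanningTrees {V : Type*} (G : SimpleGraph V) : Set (SimpleGraph V) :=
  {T | T ≤ G ∧ T.IsTree}

open scoped Classical in
/-- The value `∏_{e ∈ E(T)} w(e)` of a graph `T`. -/
def treeValue {V : Type*} [Fintype V] (w : KEdge V → ℝ) (T : SimpleGraph V) : ℝ :=
  ∏ e : KEdge V, if (e : Sym2 V) ∈ T.edgeSet then w e else 1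

open scoped Classical in
/-- The weighted number of spanning trees `t_w(G)`. -/
def weightedTreeCount {V : Type*} [Fintype V] (w : KEdge V → ℝ) (G : SimpleGraph V) : ℝ :=
  ∑ T : SimpleGraph V with T ∈ spanningTrees G, treeValue w T

/-! ### Random graphs -/

/-- The spanning subgraph of `G₀` whose edges are the edges `e` of `G₀` with `s e = true`. -/
def selectEdges {V : Type*} (G₀ : SimpleGraph V) (s : G₀.edgeSet → Bool) : SimpleGraph V :=
  SimpleGraph.fromEdgeSet {e | ∃ h : e ∈ G₀.edgeSet, s ⟨e, h⟩ = true}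

/-- The law of the random spanning subgraph of `G₀` in which each edge `e` of `G₀` is
present with probability `p e`, independently of the other edges: the image of a product of
Bernoulli measures, one for each edge of `G₀`. -/
def randomGraph {V : Type*} [Fintype V] (G₀ : SimpleGraph V) (p : G₀.edgeSet → unitInterval) :
    MeasureTheory.Measure (SimpleGraph V) :=
  (MeasureTheory.Measure.infinitePi fun e : G₀.edgeSet =>
    ProbabilityTheory.bernoulliMeasure true false (p e)).map (selectEdges G₀)

theorem measurable_selectEdges {V : Type*} [Fintype V] (G₀ : SimpleGraph V) :
    Measurable (selectEdges G₀) :=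
  measurable_of_countable _

instance isProbabilityMeasure_randomGraph {V : Type*} [Fintype V] (G₀ : SimpleGraph V)
    (p : G₀.edgeSet → unitInterval) : MeasureTheory.IsProbabilityMeasure (randomGraph G₀ p) :=
  MeasureTheory.Measure.isProbabilityMeasure_map (measurable_selectEdges G₀).aemeasurable

/-- The edge probabilities `p : E(K_n) → [0, 1]`, restricted to the edges of `G₀`. -/
def restrictProb {V : Type*} (p : KEdge V → unitInterval) (G₀ : SimpleGraph V) :
    G₀.edgeSet → unitInterval :=
  fun e => p ⟨e, SimpleGraph.edgeSet_mono le_top e.2⟩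

/-- The set function sending `E ⊆ E(K_n)` to the expected weighted number of spanning trees of
the random spanning subgraph of `(V, E)` with edge probabilities `p`. -/
def expectedTree {V : Type*} [Fintype V] (w : KEdge V → ℝ) (p : KEdge V → unitInterval)
    (E : Finset (KEdge V)) : ℝ :=
  ∫ G, weightedTreeCount w G ∂(randomGraph (graphOn (E : Set (KEdge V)))
    (restrictProb p (graphOn (E : Set (KEdge V)))))

/-- The logarithm of the expected weighted number of spanning trees where this is positive,
and `0` elsewhere. -/
def logExpectedTree {V : Type*} [Fintype V] (w : KEdge V → ℝ) (p : KEdge V → unitInterval)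
    (E : Finset (KEdge V)) : ℝ :=
  if 0 < expectedTree w p E then Real.log (expectedTree w p E) else 0

/-- The logarithmic gain of the expected weighted number of spanning trees from adding the
edges `E` to the base graph `(V, Einit)`. -/
def logExpectedTreeGain {V : Type*} [Fintype V] [DecidableEq V] (w : KEdge V → ℝ)
    (p : KEdge V → unitInterval) (Einit E : Finset (KEdge V)) : ℝ :=
  logExpectedTree w p (E ∪ Einit) - logExpectedTree w p Einit

end

/-! A fixed spanning tree survives in the random graph with probability `∏ p e` over its edges. By
linearity of expectation `ξ(E)` is therefore the deterministic `treeSum x E` with `x e = w e * p e ≥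
0` (`expectedTree_eq_treeSum`). Monotonicity and supermodularity follow: all terms are nonnegative,
and the gain from an edge `s` is the sum over trees through `s`, whose family grows with `E`.

For log-submodularity, the matrix-tree theorem `det_reducedLaplacian` turns `treeSum` into a
determinant, and inserting an edge into a rank one update. Two such updates of an invertible
symmetric `A` multiply `det A` by `(1 + a uᵀA⁻¹u)(1 + b vᵀA⁻¹v) - ab (uᵀA⁻¹v)²`, at most the product
of the two separate factors. This is diminishing returns for the logarithm; connectedness of the
base graph keeps the determinants positive. -/

/-! ### Determinant identities and inequalities -/

/-- A weighted Cauchy-Binet expansion of the Gram determinant. -/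
theorem det_sum_mul_mul_eq_sum_powersetCard {ι W R : Type*} [Fintype ι] [DecidableEq ι]
    [DecidableEq W] [CommRing R] (E : Finset W) (x : W → R) (v : W → ι → R) :
    (Matrix.of fun i j => ∑ e ∈ E, x e * v e i * v e j).det =
      ∑ S ∈ E.powersetCard (Fintype.card ι),
        (∏ e ∈ S, x e) * (Matrix.of fun i j => ∑ e ∈ S, v e i * v e j).det := by
  -- Expanding every row multilinearly gives one term per choice `φ` of an index for each row; `c φ`
  -- is its part free of `x`.
  set c : (ι → W) → R := fun φ => (∏ i, v (φ i) i) * (Matrix.of fun i => v (φ i)).det with hc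
  have c_zero : ∀ φ, ¬ Function.Injective φ → c φ = 0 := by
    intro φ hφ
    simp only [Function.Injective, not_forall] at hφ
    obtain ⟨i, j, hij, hne⟩ := hφ
    rw [hc]
    simp only
    rw [Matrix.det_zero_of_row_eq hne (by ext k; simp [hij]), mul_zero]
  have key : ∀ (E : Finset W) (x : W → R),
      (Matrix.of fun i j => ∑ e ∈ E, x e * v e i * v e j).det =
        ∑ φ ∈ Fintype.piFinset (fun _ : ι => E) with Function.Injective φ,
          (∏ i, x (φ i)) * c φ := by
    intro E x
    have h1 : (Matrix.of fun i j => ∑ e ∈ E, x e * v e i * v e j) =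
        fun i => ∑ e ∈ E, (x e * v e i) • v e := by
      ext i j
      simp [Finset.sum_apply]
    rw [h1]
    change (Matrix.detRowAlternating (R := R) (n := ι)).toMultilinearMap _ = _
    rw [MultilinearMap.map_sum_finset, Finset.sum_filter]
    refine Finset.sum_congr rfl fun φ _ => ?_
    rw [MultilinearMap.map_smul_univ, Finset.prod_mul_distrib, smul_eq_mul]
    split_ifs with h
    · simp only [hc]
      rw [mul_assoc]; rfl
    · have := c_zero φ h
      simp only [hc] at this
      rw [mul_assoc]
      exact (congrArg _ this).trans (mul_zero _)
  -- Group the injective `φ` by image `S`; each group is the same expansion for `S` with unit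
  -- weights.
  rw [key, ← Finset.sum_fiberwise_of_maps_to (t := E.powersetCard (Fintype.card ι))
    (g := fun φ : ι → W => Finset.univ.image φ)]
  · refine Finset.sum_congr rfl fun S hS => ?_
    rw [Finset.mem_powersetCard] at hS
    have h2 := key S (fun _ => 1)
    simp only [one_mul, Finset.prod_const_one] at h2
    rw [h2, Finset.mul_sum]
    refine Finset.sum_congr ?_ ?_
    · ext φ
      simp only [Finset.mem_filter, Fintype.mem_piFinset]
      constructor
      · rintro ⟨⟨_, h⟩, rfl⟩
        exact ⟨fun i => Finset.mem_image_of_mem _ (Finset.mem_univ i), h⟩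
      · rintro ⟨h, hi⟩
        refine ⟨⟨fun i => hS.1 (h i), hi⟩, Finset.eq_of_subset_of_card_le ?_ ?_⟩
        · intro e he
          obtain ⟨i, _, rfl⟩ := Finset.mem_image.1 he
          exact h i
        · rw [hS.2, Finset.card_image_of_injective _ hi, Finset.card_univ]
    · intro φ hφ
      simp only [Finset.mem_filter, Fintype.mem_piFinset] at hφ
      have h3 : ∀ i, φ i ∈ S := hφ.1
      have : Finset.univ.image φ = S := by
        refine Finset.eq_of_subset_of_card_le ?_ ?_
        · intro e he
          obtain ⟨i, _, rfl⟩ := Finset.mem_image.1 he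
          exact h3 i
        · rw [hS.2, Finset.card_image_of_injective _ hφ.2, Finset.card_univ]
      rw [← this, Finset.prod_image (fun a _ b _ h => hφ.2 h)]
  · intro φ hφ
    simp only [Finset.mem_filter, Fintype.mem_piFinset] at hφ
    rw [Finset.mem_powersetCard, Finset.card_image_of_injective _ hφ.2, Finset.card_univ]
    refine ⟨?_, rfl⟩
    intro e he
    obtain ⟨i, _, rfl⟩ := Finset.mem_image.1 he
    exact hφ.1 i

open Matrix in
/-- Rayleigh inequality for rank one updates of a symmetric matrix. -/
theorem Matrix.IsSymm.det_mul_det_add_add_le {ι : Type*} [Fintype ι] [DecidableEq ι]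
    {A : Matrix ι ι ℝ} (hA : A.IsSymm) (hdet : A.det ≠ 0) (u v : ι → ℝ) {a b : ℝ}
    (ha : 0 ≤ a) (hb : 0 ≤ b) :
    (A + a • vecMulVec u u + b • vecMulVec v v).det * A.det ≤
      (A + a • vecMulVec u u).det * (A + b • vecMulVec v v).det := by
  have hu : IsUnit A.det := isUnit_iff_ne_zero.2 hdet
  have main : ∀ a b : ℝ, (A + a • vecMulVec u u + b • vecMulVec v v).det =
      A.det * ((1 + a * (u ⬝ᵥ A⁻¹ *ᵥ u)) * (1 + b * (v ⬝ᵥ A⁻¹ *ᵥ v))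
        - a * b * (u ⬝ᵥ A⁻¹ *ᵥ v) ^ 2) := by
    intro a b
    have hsymm : v ⬝ᵥ A⁻¹ *ᵥ u = u ⬝ᵥ A⁻¹ *ᵥ v := by
      have : (A⁻¹)ᵀ = A⁻¹ := by rw [Matrix.transpose_nonsing_inv, hA.eq]
      rw [Matrix.dotProduct_mulVec, ← Matrix.mulVec_transpose, this, dotProduct_comm]
    -- Both updates together are `U * C` of rank at most two, so `det (1 + A⁻¹UC) = det (1 + CA⁻¹U)`
    -- leaves a 2 × 2 determinant.
    set U : Matrix ι (Fin 2) ℝ := Matrix.of fun i k => ![a * u i, b * v i] k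
    set C : Matrix (Fin 2) ι ℝ := Matrix.of ![u, v]
    have h1 : A + a • vecMulVec u u + b • vecMulVec v v = A * (1 + A⁻¹ * U * C) := by
      rw [mul_add, mul_one, Matrix.mul_assoc, Matrix.mul_nonsing_inv_cancel_left _ _ hu, add_assoc]
      congr 1
      ext i j
      simp [Matrix.mul_apply, U, C, vecMulVec_apply, Fin.sum_univ_two, mul_assoc]
    have h2 : ∀ k l, (C * (A⁻¹ * U)) k l = ![a, b] l * (![u, v] k ⬝ᵥ A⁻¹ *ᵥ ![u, v] l) := by
      intro k l
      have : (fun i => U i l) = ![a, b] l • ![u, v] l := by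
        ext i; fin_cases l <;> simp [U]
      have h3 : (C * (A⁻¹ * U)) k l = ![u, v] k ⬝ᵥ A⁻¹ *ᵥ (fun i => U i l) := by
        rw [Matrix.mul_apply]; rfl
      rw [h3, this, Matrix.mulVec_smul, dotProduct_smul, smul_eq_mul]
    rw [h1, Matrix.det_mul, Matrix.det_one_add_mul_comm, Matrix.det_fin_two]
    simp only [Matrix.add_apply, h2]
    congr 1
    simp [hsymm]
    ring
  have e1 := main a b
  have e2 := main a 0
  have e3 := main 0 b
  simp only [zero_smul, add_zero] at e2 e3
  rw [e1, e2, e3]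
  -- The two sides differ by exactly this square times `ab`.
  nlinarith [mul_nonneg (mul_nonneg ha hb) (sq_nonneg (A.det * (u ⬝ᵥ A⁻¹ *ᵥ v)))]

/-! ### Incidence matrices and the matrix-tree theorem -/

noncomputable section
theorem edgeSet_graphOn {V : Type*} (S : Set (KEdge V)) :
    (graphOn S).edgeSet = Subtype.val '' S := by
  rw [graphOn, SimpleGraph.edgeSet_fromEdgeSet, sdiff_eq_left, Set.disjoint_left]
  rintro _ ⟨e, _, rfl⟩
  exact SimpleGraph.not_isDiag_of_mem_edgeSet _ e.2

theorem natCard_edgeSet_graphOn {V : Type*} (S : Finset (KEdge V)) :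
    Nat.card (graphOn (S : Set (KEdge V))).edgeSet = S.card := by
  rw [edgeSet_graphOn, Nat.card_image_of_injective Subtype.val_injective]
  simp

/-- The column of the edge `e` in the vertex-edge incidence matrix, for some orientation of `e`. -/
def incidenceVec {V : Type*} [DecidableEq V] (R : Type*) [Ring R] (e : KEdge V) (u : V) : R :=
  (if u = (Quot.out (e : Sym2 V)).1 then 1 else 0) - if u = (Quot.out (e : Sym2 V)).2 then 1 else 0

theorem sym2_mk_out {V : Type*} (e : KEdge V) :
    s((Quot.out (e : Sym2 V)).1, (Quot.out (e : Sym2 V)).2) = (e : Sym2 V) :=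
  Quot.out_eq _

theorem sum_incidenceVec_mul {V : Type*} [Fintype V] [DecidableEq V] {R : Type*} [Ring R]
    (r : V) (e : KEdge V) (y : V → R) (hy : y r = 0) :
    ∑ u : {u : V // u ≠ r}, incidenceVec R e u * y u =
      y (Quot.out (e : Sym2 V)).1 - y (Quot.out (e : Sym2 V)).2 := by
  have h := Fintype.sum_subtype_add_sum_subtype (fun u => u ≠ r)
    (fun u => incidenceVec R e u * y u)
  have h0 : ∑ u : {u : V // ¬ u ≠ r}, incidenceVec R e u * y u = 0 := by
    refine Finset.sum_eq_zero fun u _ => ?_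
    have : (u : V) = r := not_not.1 u.2
    rw [this, hy, mul_zero]
  rw [h0, add_zero] at h
  rw [h]
  simp [incidenceVec, sub_mul, Finset.sum_sub_distrib]

/-- The incidence matrix of an edge set with the row of the root `r` deleted (transposed). -/
def incidenceRows {V : Type*} [DecidableEq V] (R : Type*) [Ring R] (r : V) {ι : Type*}
    (f : ι → KEdge V) : Matrix ι {u : V // u ≠ r} R :=
  Matrix.of fun i u => incidenceVec R (f i) u

theorem map_incidenceRows {V : Type*} [DecidableEq V] (R : Type*) [Ring R] (r : V) {ι : Type*}
    (f : ι → KEdge V) : (incidenceRows ℤ r f).map (Int.castRingHom R) = incidenceRows R r f := by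
  ext i u
  simp only [incidenceRows, incidenceVec, Matrix.map_apply, Matrix.of_apply, map_sub]
  split_ifs <;> simp

theorem extend_root_apply {V R : Type*} [Zero R] (r : V) [DecidableEq V] (y : {u : V // u ≠ r} → R)
    (u : {u : V // u ≠ r}) : (if h : (u : V) ≠ r then y ⟨u, h⟩ else 0) = y u := by
  simp [u.2]

theorem incidenceRows_mulVec_eq_zero_iff {V : Type*} [Fintype V] [DecidableEq V] {R : Type*}
    [CommRing R] (r : V) {ι : Type*} (f : ι → KEdge V) (y : V → R) (hy : y r = 0) :
    (incidenceRows R r f).mulVec (fun u => y u) = 0 ↔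
      ∀ u v, (graphOn (Set.range f)).Adj u v → y u = y v := by
  have h : ∀ i, (incidenceRows R r f).mulVec (fun u => y u) i =
      y (Quot.out (f i : Sym2 V)).1 - y (Quot.out (f i : Sym2 V)).2 :=
    fun i => sum_incidenceVec_mul r (f i) y hy
  constructor
  · intro h0 u v huv
    rw [← SimpleGraph.mem_edgeSet, edgeSet_graphOn] at huv
    obtain ⟨_, ⟨i, rfl⟩, hi⟩ := huv
    have h1 := h i
    rw [h0, Pi.zero_apply, eq_comm, sub_eq_zero] at h1
    rw [← sym2_mk_out] at hi
    rcases Sym2.eq_iff.1 hi with ⟨h2, h3⟩ | ⟨h2, h3⟩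
    · rw [← h2, ← h3, h1]
    · rw [← h2, ← h3, h1]
  · intro h1
    ext i
    rw [h i, Pi.zero_apply, sub_eq_zero]
    apply h1
    rw [← SimpleGraph.mem_edgeSet, edgeSet_graphOn, sym2_mk_out]
    exact ⟨_, ⟨i, rfl⟩, rfl⟩

theorem SimpleGraph.Reachable.apply_eq {V R : Type*} {G : SimpleGraph V} {y : V → R}
    (hy : ∀ u v, G.Adj u v → y u = y v) {u v : V} (h : G.Reachable u v) : y u = y v := by
  obtain ⟨p⟩ := h
  induction p with
  | nil => rfl
  | cons hadj _ ih => exact (hy _ _ hadj).trans ih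

/-- A kernel vector, extended by `0` at the root, is constant along edges, hence zero by
connectedness. -/
theorem det_incidenceRows_ne_zero {V : Type*} [Fintype V] [DecidableEq V] {R : Type*}
    [CommRing R] [IsDomain R] (r : V) (f : {u : V // u ≠ r} → KEdge V)
    (hf : (graphOn (Set.range f)).Connected) : (incidenceRows R r f).det ≠ 0 := by
  intro h0
  obtain ⟨y, hy, hy0⟩ := Matrix.exists_mulVec_eq_zero_iff.2 h0
  apply hy
  set z : V → R := fun u => if h : u ≠ r then y ⟨u, h⟩ else 0 with hz
  have hzr : z r = 0 := by simp [hz]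
  have hzy : (fun u : {u : V // u ≠ r} => z u) = y := funext fun u => extend_root_apply r y u
  rw [← hzy, incidenceRows_mulVec_eq_zero_iff r f z hzr] at hy0
  rw [← hzy]
  ext u
  exact (SimpleGraph.Reachable.apply_eq hy0 (hf.preconnected u r)).trans hzr

/-- The determinant is nonzero over `ZMod q` for every prime `q`, so no prime divides the integer
determinant, which must be `±1`. -/
theorem sq_det_incidenceRows_of_connected {V : Type*} [Fintype V] [DecidableEq V]
    (r : V) (f : {u : V // u ≠ r} → KEdge V) (hf : (graphOn (Set.range f)).Connected) :
    (incidenceRows ℤ r f).det ^ 2 = 1 := by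
  have h1 : (incidenceRows ℤ r f).det.natAbs = 1 := by
    by_contra hne
    obtain ⟨q, hq, hdvd⟩ := Nat.exists_prime_and_dvd hne
    have : Fact q.Prime := ⟨hq⟩
    apply det_incidenceRows_ne_zero (R := ZMod q) r f hf
    rw [← map_incidenceRows, ← RingHom.mapMatrix_apply, ← RingHom.map_det, eq_intCast,
      ZMod.intCast_zmod_eq_zero_iff_dvd]
    exact Int.natCast_dvd.2 hdvd
  rw [← Int.natAbs_sq, h1]
  rfl

theorem det_incidenceRows_of_not_connected {V : Type*} [Fintype V] [DecidableEq V]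
    (r : V) (f : {u : V // u ≠ r} → KEdge V) (hf : ¬ (graphOn (Set.range f)).Connected) :
    (incidenceRows ℤ r f).det = 0 := by
  classical
  have : Nonempty V := ⟨r⟩
  obtain ⟨u, hu⟩ : ∃ u, ¬ (graphOn (Set.range f)).Reachable r u := by
    by_contra! h
    exact hf ⟨fun u v => (h u).symm.trans (h v)⟩
  -- The indicator of the vertices not reachable from the root is a nonzero kernel vector.
  set y : V → ℤ := fun v => if (graphOn (Set.range f)).Reachable r v then 0 else 1 with hy
  have hyr : y r = 0 := by simp [hy]
  refine Matrix.exists_mulVec_eq_zero_iff.1 ⟨fun v => y v, ?_,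
    (incidenceRows_mulVec_eq_zero_iff r f y hyr).2 ?_⟩
  · intro h
    have hur : u ≠ r := by
      rintro rfl
      exact hu (SimpleGraph.Reachable.refl _)
    have := congrFun h ⟨u, hur⟩
    simp [hy, hu] at this
  · intro a b hab
    have : (graphOn (Set.range f)).Reachable r a ↔ (graphOn (Set.range f)).Reachable r b :=
      ⟨fun h => h.trans hab.reachable, fun h => h.trans hab.reachable.symm⟩
    simp [hy, this]

theorem det_sum_incidenceVec_mul {V : Type*} [Fintype V] [DecidableEq V] (r : V)
    {S : Finset (KEdge V)} (hS : S.card = Fintype.card {u : V // u ≠ r}) {R : Type*} [CommRing R] :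
    (Matrix.of fun u v : {u : V // u ≠ r} =>
      ∑ e ∈ S, incidenceVec R e u * incidenceVec R e v).det =
      open scoped Classical in if (graphOn (S : Set (KEdge V))).IsTree then 1 else 0 := by
  classical
  -- Indexing the edges by the non-root vertices makes the incidence matrix square, so the Gram
  -- determinant is a square.
  obtain ⟨g⟩ : Nonempty ({u : V // u ≠ r} ≃ S) :=
    Fintype.card_eq.1 (by rw [← hS, Fintype.card_coe])
  set f : {u : V // u ≠ r} → KEdge V := fun u => g u
  have hrange : Set.range f = (S : Set (KEdge V)) := by
    ext e
    constructor
    · rintro ⟨u, rfl⟩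
      exact (g u).2
    · intro he
      exact ⟨g.symm ⟨e, he⟩, by simp [f]⟩
  have hmul : (Matrix.of fun u v : {u : V // u ≠ r} =>
      ∑ e ∈ S, incidenceVec R e u * incidenceVec R e v) =
      (incidenceRows R r f).transpose * incidenceRows R r f := by
    ext u v
    rw [Matrix.mul_apply, Matrix.of_apply, ← Finset.sum_coe_sort, ← g.sum_comp]
    rfl
  have htree : (graphOn (S : Set (KEdge V))).IsTree ↔ (graphOn (S : Set (KEdge V))).Connected := by
    rw [SimpleGraph.isTree_iff_connected_and_card, natCard_edgeSet_graphOn, hS,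
      Fintype.card_subtype_compl, Fintype.card_subtype_eq, Nat.card_eq_fintype_card]
    have : 0 < Fintype.card V := Fintype.card_pos_iff.2 ⟨r⟩
    exact and_iff_left (by omega)
  rw [hmul, Matrix.det_mul, Matrix.det_transpose, ← pow_two, ← map_incidenceRows,
    ← RingHom.mapMatrix_apply, ← RingHom.map_det, ← map_pow]
  split_ifs with h
  · rw [sq_det_incidenceRows_of_connected r f (by rw [hrange]; exact htree.1 h), map_one]
  · rw [det_incidenceRows_of_not_connected r f (by rw [hrange]; exact fun hc => h (htree.2 hc))]
    simp

/-- The spanning trees of `(V, E)` as edge sets. -/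
def treeEdgeSets {V : Type*} (E : Finset (KEdge V)) : Finset (Finset (KEdge V)) :=
  open scoped Classical in
  E.powerset.filter fun S => (graphOn (S : Set (KEdge V))).IsTree

theorem mem_treeEdgeSets {V : Type*} {E S : Finset (KEdge V)} :
    S ∈ treeEdgeSets E ↔ S ⊆ E ∧ (graphOn (S : Set (KEdge V))).IsTree := by
  simp [treeEdgeSets]

/-- The generating polynomial of the spanning trees of `(V, E)`. -/
def treeSum {V : Type*} (x : KEdge V → ℝ) (E : Finset (KEdge V)) : ℝ :=
  ∑ S ∈ treeEdgeSets E, ∏ e ∈ S, x e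

/-- The weighted Laplacian of `(V, E)` with the row and column of `r` deleted. -/
def reducedLaplacian {V : Type*} [DecidableEq V] (x : KEdge V → ℝ) (r : V)
    (E : Finset (KEdge V)) : Matrix {u : V // u ≠ r} {u : V // u ≠ r} ℝ :=
  Matrix.of fun u v => ∑ e ∈ E, x e * incidenceVec ℝ e u * incidenceVec ℝ e v

/-- The weighted matrix-tree theorem. -/
theorem det_reducedLaplacian {V : Type*} [Fintype V] [DecidableEq V] (x : KEdge V → ℝ) (r : V)
    (E : Finset (KEdge V)) : (reducedLaplacian x r E).det = treeSum x E := by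
  classical
  have h := det_sum_mul_mul_eq_sum_powersetCard E x
    (fun e (u : {u : V // u ≠ r}) => incidenceVec ℝ e u)
  rw [reducedLaplacian, h, treeSum]
  have hsub : treeEdgeSets E ⊆ E.powersetCard (Fintype.card {u : V // u ≠ r}) := by
    intro S hS
    rw [mem_treeEdgeSets] at hS
    refine Finset.mem_powersetCard.2 ⟨hS.1, ?_⟩
    have h2 := (SimpleGraph.isTree_iff_connected_and_card.1 hS.2).2
    rw [natCard_edgeSet_graphOn, Nat.card_eq_fintype_card] at h2
    rw [Fintype.card_subtype_compl, Fintype.card_subtype_eq]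
    omega
  rw [← Finset.sum_subset hsub]
  · refine Finset.sum_congr rfl fun S hS => ?_
    rw [det_sum_incidenceVec_mul r (Finset.mem_powersetCard.1 (hsub hS)).2,
      if_pos (mem_treeEdgeSets.1 hS).2, mul_one]
  · intro S hS hS'
    rw [Finset.mem_powersetCard] at hS
    rw [det_sum_incidenceVec_mul r hS.2, if_neg, mul_zero]
    exact fun ht => hS' (mem_treeEdgeSets.2 ⟨hS.1, ht⟩)

theorem reducedLaplacian_insert {V : Type*} [DecidableEq V] (x : KEdge V → ℝ) (r : V)
    {E : Finset (KEdge V)} {s : KEdge V} (hs : s ∉ E) :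
    reducedLaplacian x r (insert s E) = reducedLaplacian x r E +
      x s • Matrix.vecMulVec (fun u : {u : V // u ≠ r} => incidenceVec ℝ s u)
        (fun u : {u : V // u ≠ r} => incidenceVec ℝ s u) := by
  ext u v
  simp [reducedLaplacian, Finset.sum_insert hs, Matrix.vecMulVec_apply, mul_assoc, add_comm]

/-! ### Monotonicity, supermodularity and log-submodularity of the tree sum -/

theorem treeSum_mul_treeSum_le {V : Type*} [Fintype V] [DecidableEq V] [Nonempty V]
    {x : KEdge V → ℝ} (hx : ∀ e, 0 ≤ x e) {E : Finset (KEdge V)} (hE : treeSum x E ≠ 0)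
    {s t : KEdge V} (hs : s ∉ E) (ht : t ∉ E) (hst : s ≠ t) :
    treeSum x (insert s (insert t E)) * treeSum x E ≤
      treeSum x (insert s E) * treeSum x (insert t E) := by
  obtain ⟨r⟩ := ‹Nonempty V›
  have hsymm : (reducedLaplacian x r E).IsSymm := by
    ext u v
    exact Finset.sum_congr rfl fun e _ => mul_right_comm _ _ _
  have h := hsymm.det_mul_det_add_add_le (by rwa [det_reducedLaplacian])
    (fun u : {u : V // u ≠ r} => incidenceVec ℝ t u)
    (fun u : {u : V // u ≠ r} => incidenceVec ℝ s u) (hx t) (hx s)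
  rw [← reducedLaplacian_insert x r ht, ← reducedLaplacian_insert x r hs,
    ← reducedLaplacian_insert x r (by simp [hs, hst])] at h
  simp only [det_reducedLaplacian] at h
  rw [mul_comm (treeSum x (insert s E))]
  exact h

theorem treeSum_mono {V : Type*} {x : KEdge V → ℝ} (hx : ∀ e, 0 ≤ x e) :
    Monotone (treeSum x) := by
  intro A B hAB
  refine Finset.sum_le_sum_of_subset_of_nonneg ?_ fun _ _ _ => Finset.prod_nonneg fun e _ => hx e
  intro S hS
  rw [mem_treeEdgeSets] at hS ⊢
  exact ⟨hS.1.trans hAB, hS.2⟩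

theorem treeSum_empty {V : Type*} [Fintype V] (hV : 2 ≤ Fintype.card V) (x : KEdge V → ℝ) :
    treeSum x ∅ = 0 := by
  refine Finset.sum_eq_zero fun S hS => ?_
  rw [mem_treeEdgeSets, Finset.subset_empty] at hS
  obtain ⟨rfl, hT⟩ := hS
  have h2 := (SimpleGraph.isTree_iff_connected_and_card.1 hT).2
  rw [natCard_edgeSet_graphOn, Nat.card_eq_fintype_card, Finset.card_empty] at h2
  omega

theorem treeSum_insert_sub {V : Type*} [DecidableEq V] (x : KEdge V → ℝ) {E : Finset (KEdge V)}
    {s : KEdge V} (hs : s ∉ E) :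
    treeSum x (insert s E) - treeSum x E =
      ∑ S ∈ treeEdgeSets (insert s E) with s ∈ S, ∏ e ∈ S, x e := by
  rw [sub_eq_iff_eq_add, treeSum, ← Finset.sum_filter_add_sum_filter_not _ (fun S => s ∈ S)]
  congr 1
  refine Finset.sum_congr ?_ fun _ _ => rfl
  ext S
  simp only [Finset.mem_filter, mem_treeEdgeSets]
  constructor
  · rintro ⟨⟨h1, h2⟩, h3⟩
    exact ⟨(Finset.subset_insert_iff_of_notMem h3).1 h1, h2⟩
  · rintro ⟨h1, h2⟩
    exact ⟨⟨h1.trans (Finset.subset_insert _ _), h2⟩, fun h => hs (h1 h)⟩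

theorem isSupermodular_treeSum {V : Type*} [DecidableEq V] {x : KEdge V → ℝ}
    (hx : ∀ e, 0 ≤ x e) : IsSupermodular (treeSum x) := by
  intro A B hAB s hs
  have h : treeSum x (insert s A) - treeSum x A ≤ treeSum x (insert s B) - treeSum x B := by
    rw [treeSum_insert_sub x hs, treeSum_insert_sub x fun h => hs (hAB h)]
    refine Finset.sum_le_sum_of_subset_of_nonneg ?_
      fun _ _ _ => Finset.prod_nonneg fun e _ => hx e
    intro S hS
    simp only [Finset.mem_filter, mem_treeEdgeSets] at hS ⊢
    exact ⟨⟨hS.1.1.trans (Finset.insert_subset_insert _ hAB), hS.1.2⟩, hS.2⟩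
  linarith

/-- The elements of `B \ A` can be removed one at a time, each step costing one instance of the
local inequality. -/
theorem isSubmodular_of_insert_insert {W : Type*} [DecidableEq W] {f : Finset W → ℝ}
    (hf : ∀ (A : Finset W) (s t : W), s ∉ A → t ∉ A → s ≠ t →
      f (insert s (insert t A)) + f A ≤ f (insert s A) + f (insert t A)) : IsSubmodular f := by
  intro A B hAB
  induction B using Finset.strongInduction with
  | H B ih =>
    intro s hs
    rcases hAB.eq_or_ssubset with rfl | hlt
    · exact le_rfl
    obtain ⟨t, htB, htA⟩ := Finset.exists_of_ssubset hlt
    have h1 := ih (B.erase t) (Finset.erase_ssubset htB) (Finset.subset_erase.2 ⟨hAB, htA⟩) s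
      fun h => hs (Finset.mem_of_mem_erase h)
    have h2 := hf (B.erase t) s t (fun h => hs (Finset.mem_of_mem_erase h))
      (Finset.notMem_erase t B) (by rintro rfl; exact hs htB)
    rw [Finset.insert_erase htB] at h2
    linarith

theorem isSubmodular_log_treeSum_union {V : Type*} [Fintype V] [DecidableEq V] [Nonempty V]
    {x : KEdge V → ℝ} (hx : ∀ e, 0 ≤ x e) {E₀ : Finset (KEdge V)}
    (hpos : ∀ E, 0 < treeSum x (E ∪ E₀)) :
    IsSubmodular fun E : Finset (KEdge V) => Real.log (treeSum x (E ∪ E₀)) := by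
  refine isSubmodular_of_insert_insert fun A s t hs ht hst => ?_
  simp only [Finset.insert_union]
  -- Inserting an edge already in `E₀` changes nothing, and the inequality becomes an equality.
  by_cases hs' : s ∈ E₀
  · rw [Finset.insert_eq_of_mem (a := s) (by simp [hs']),
      Finset.insert_eq_of_mem (a := s) (by simp [hs']), add_comm]
  by_cases ht' : t ∈ E₀
  · rw [Finset.insert_eq_of_mem (a := t) (by simp [ht'])]
  have h := treeSum_mul_treeSum_le hx (hpos A).ne' (s := s) (t := t)
    (by simp [hs, hs']) (by simp [ht, ht']) hst
  have hp1 := hpos (insert s (insert t A))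
  have hp2 := hpos (insert s A)
  have hp3 := hpos (insert t A)
  simp only [Finset.insert_union] at hp1 hp2 hp3
  rw [← Real.log_mul hp1.ne' (hpos A).ne', ← Real.log_mul hp2.ne' hp3.ne']
  exact Real.log_le_log (mul_pos hp1 (hpos A)) h

/-! ### Graphs versus edge sets -/

/-- The edges of `T`, as edges of the complete graph. -/
def completeEdges {V : Type*} [Fintype V] (T : SimpleGraph V) : Finset (KEdge V) :=
  (Set.toFinite {e : KEdge V | (e : Sym2 V) ∈ T.edgeSet}).toFinset

theorem mem_completeEdges {V : Type*} [Fintype V] {T : SimpleGraph V} {e : KEdge V} :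
    e ∈ completeEdges T ↔ (e : Sym2 V) ∈ T.edgeSet := by
  simp [completeEdges]

theorem graphOn_completeEdges {V : Type*} [Fintype V] (T : SimpleGraph V) :
    graphOn (completeEdges T : Set (KEdge V)) = T := by
  rw [← SimpleGraph.edgeSet_inj, edgeSet_graphOn]
  ext e
  constructor
  · rintro ⟨e, he, rfl⟩
    exact mem_completeEdges.1 he
  · intro he
    exact ⟨⟨e, SimpleGraph.edgeSet_mono le_top he⟩, mem_completeEdges.2 he, rfl⟩

theorem mem_edgeSet_graphOn_iff {V : Type*} {S : Set (KEdge V)} {e : KEdge V} :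
    (e : Sym2 V) ∈ (graphOn S).edgeSet ↔ e ∈ S := by
  rw [edgeSet_graphOn, Subtype.val_injective.mem_set_image]

theorem completeEdges_graphOn {V : Type*} [Fintype V] (S : Finset (KEdge V)) :
    completeEdges (graphOn (S : Set (KEdge V))) = S := by
  ext e
  rw [mem_completeEdges, mem_edgeSet_graphOn_iff, Finset.mem_coe]

/-- A spanning tree of the positive-weight edges contributes a positive term. -/
theorem treeSum_pos_of_connected {V : Type*} [Fintype V] {x : KEdge V → ℝ} (hx : ∀ e, 0 ≤ x e)
    {E : Finset (KEdge V)} (hE : (graphOn {e | e ∈ E ∧ 0 < x e}).Connected) :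
    0 < treeSum x E := by
  classical
  obtain ⟨T, hT, htree⟩ := hE.exists_isTree_le
  set S := completeEdges T
  have hTS : graphOn (S : Set (KEdge V)) = T := graphOn_completeEdges T
  have hmem : ∀ e ∈ S, e ∈ E ∧ 0 < x e := by
    intro e he
    have h1 : (e : Sym2 V) ∈ T.edgeSet := mem_completeEdges.1 he
    have h2 := SimpleGraph.edgeSet_mono hT h1
    exact mem_edgeSet_graphOn_iff.1 h2
  refine lt_of_lt_of_le (Finset.prod_pos fun e he => (hmem e he).2)
    (Finset.single_le_sum (f := fun S => ∏ e ∈ S, x e)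
      (fun _ _ => Finset.prod_nonneg fun e _ => hx e)
      (mem_treeEdgeSets.2 ⟨fun e he => (hmem e he).1, ?_⟩))
  rwa [hTS]

end

theorem treeValue_eq_prod {V : Type*} [Fintype V] (w : KEdge V → ℝ) (T : SimpleGraph V) :
    treeValue w T = ∏ e ∈ completeEdges T, w e := by
  classical
  rw [treeValue, ← Finset.prod_filter]
  refine Finset.prod_congr ?_ fun _ _ => rfl
  ext e
  simp [mem_completeEdges]

theorem weightedTreeCount_eq_sum {V : Type*} [Fintype V] (w : KEdge V → ℝ) (G : SimpleGraph V) :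
    weightedTreeCount w G = ∑ S ∈ treeEdgeSets (completeEdges G), ∏ e ∈ S, w e := by
  classical
  refine Finset.sum_nbij' completeEdges (fun S => graphOn (S : Set (KEdge V))) ?_ ?_ ?_ ?_ ?_
  · intro T hT
    obtain ⟨h1, h2⟩ := (Finset.mem_filter.1 hT).2
    rw [mem_treeEdgeSets, graphOn_completeEdges]
    refine ⟨fun e he => ?_, h2⟩
    rw [mem_completeEdges] at he ⊢
    exact SimpleGraph.edgeSet_mono h1 he
  · intro S hS
    rw [mem_treeEdgeSets] at hS
    refine Finset.mem_filter.2 ⟨Finset.mem_univ _, ?_, hS.2⟩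
    rw [← SimpleGraph.edgeSet_subset_edgeSet, edgeSet_graphOn]
    rintro _ ⟨e, he, rfl⟩
    exact mem_completeEdges.1 (hS.1 he)
  · intro T _
    exact graphOn_completeEdges T
  · intro S _
    exact completeEdges_graphOn S
  · intro T _
    exact treeValue_eq_prod w T

/-! ### Expectation over the random subgraph -/

theorem mem_edgeSet_selectEdges {V : Type*} (G₀ : SimpleGraph V) (s : G₀.edgeSet → Bool)
    (e : Sym2 V) : e ∈ (selectEdges G₀ s).edgeSet ↔ ∃ h : e ∈ G₀.edgeSet, s ⟨e, h⟩ = true := by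
  rw [selectEdges, SimpleGraph.edgeSet_fromEdgeSet]
  constructor
  · exact fun h => h.1
  · rintro ⟨h, hs⟩
    exact ⟨⟨h, hs⟩, SimpleGraph.not_isDiag_of_mem_edgeSet _ h⟩

open MeasureTheory ProbabilityTheory in
/-- All edges of `S` are present with probability `∏ e ∈ S, p e`. -/
theorem infinitePi_bernoulliMeasure_real_pi {α : Type*} (p : α → unitInterval) (S : Finset α) :
    (Measure.infinitePi fun e => bernoulliMeasure true false (p e)).real
      (Set.pi S fun _ => {true}) = ∏ e ∈ S, (p e : ℝ) := by
  rw [measureReal_def, Measure.infinitePi_pi _ (fun _ _ => measurableSet_singleton _),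
    ENNReal.toReal_prod]
  refine Finset.prod_congr rfl fun e _ => ?_
  exact bernoulliMeasure_real_apply_of_mem_of_notMem _ (measurableSet_singleton _) rfl (by simp)

theorem measurable_of_finite_simpleGraph {V α : Type*} [Finite V] [MeasurableSpace α]
    (f : SimpleGraph V → α) : Measurable f := by
  intro t _
  rw [← Set.preimage_image_eq (f ⁻¹' t) SimpleGraph.edgeSet_injective]
  exact SimpleGraph.measurable_edgeSet (Set.toFinite _).measurableSet

open MeasureTheory ProbabilityTheory in
theorem expectedTree_eq_treeSum {V : Type*} [Fintype V] (w : KEdge V → ℝ)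
    (p : KEdge V → unitInterval) (E : Finset (KEdge V)) :
    expectedTree w p E = treeSum (fun e => w e * p e) E := by
  classical
  set G₀ := graphOn (E : Set (KEdge V)) with hG₀
  set g : G₀.edgeSet → KEdge V := fun e => ⟨e, SimpleGraph.edgeSet_mono le_top e.2⟩ with hg
  have hginj : Function.Injective g := fun a b h =>
    Subtype.ext (congrArg (Subtype.val : KEdge V → Sym2 V) h)
  set pre : Finset (KEdge V) → Finset G₀.edgeSet := fun S => S.preimage g hginj.injOn with hpre
  have image_pre : ∀ S ∈ treeEdgeSets E, (pre S).image g = S := by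
    intro S hS
    rw [hpre, Finset.image_preimage, Finset.filter_true_of_mem]
    intro e he
    have := mem_edgeSet_graphOn_iff.2 (Finset.mem_coe.2 ((mem_treeEdgeSets.1 hS).1 he))
    exact ⟨⟨e, this⟩, rfl⟩
  -- The trees range over a family independent of the sample `s`; survival of `S` is the cylinder
  -- event that all its edges are selected, so integration is termwise.
  have count : ∀ s : G₀.edgeSet → Bool, weightedTreeCount w (selectEdges G₀ s) =
      ∑ S ∈ treeEdgeSets E, (∏ e ∈ S, w e) *
        (Set.pi (pre S) fun _ => {true}).indicator (fun _ => (1 : ℝ)) s := by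
    intro s
    rw [weightedTreeCount_eq_sum]
    have hsub : treeEdgeSets (completeEdges (selectEdges G₀ s)) ⊆ treeEdgeSets E := by
      intro S hS
      rw [mem_treeEdgeSets] at hS ⊢
      refine ⟨fun e he => ?_, hS.2⟩
      obtain ⟨h, _⟩ := (mem_edgeSet_selectEdges G₀ s e).1 (mem_completeEdges.1 (hS.1 he))
      exact mem_edgeSet_graphOn_iff.1 h
    have hmem : ∀ S ∈ treeEdgeSets E, S ∈ treeEdgeSets (completeEdges (selectEdges G₀ s)) ↔
        s ∈ Set.pi (pre S) fun _ => {true} := by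
      intro S hS
      rw [mem_treeEdgeSets, and_iff_left (mem_treeEdgeSets.1 hS).2]
      constructor
      · intro h e he
        have h1 := h (Finset.mem_preimage.1 he)
        obtain ⟨_, h2⟩ := (mem_edgeSet_selectEdges G₀ s (g e)).1 (mem_completeEdges.1 h1)
        exact h2
      · intro h e he
        rw [← image_pre S hS] at he
        obtain ⟨e', he', rfl⟩ := Finset.mem_image.1 he
        rw [mem_completeEdges, mem_edgeSet_selectEdges]
        exact ⟨e'.2, h e' he'⟩
    rw [← Finset.sum_subset_zero_on_sdiff hsub]
    · intro S hS
      rw [Finset.mem_sdiff] at hS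
      rw [Set.indicator_of_notMem, mul_zero]
      exact fun h => hS.2 ((hmem S hS.1).2 h)
    · intro S hS
      rw [Set.indicator_of_mem ((hmem S (hsub hS)).1 hS), mul_one]
  rw [expectedTree, randomGraph, integral_map (measurable_selectEdges _).aemeasurable
    (measurable_of_finite_simpleGraph _).aestronglyMeasurable]
  rw [integral_congr_ae (.of_forall count)]
  rw [integral_finsetSum]
  · refine Finset.sum_congr rfl fun S hS => ?_
    rw [integral_const_mul,
      integral_indicator_const _ (Set.toFinite _).measurableSet, smul_eq_mul, mul_one,
      infinitePi_bernoulliMeasure_real_pi, Finset.prod_mul_distrib]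
    congr 1
    conv_rhs => rw [← image_pre S hS, Finset.prod_image hginj.injOn]
    rfl
  · intro S _
    exact ((integrable_const (1 : ℝ)).indicator (Set.toFinite _).measurableSet).const_mul _

theorem mainTheorem10 {V : Type*} [Fintype V] [DecidableEq V] (hV : 2 ≤ Fintype.card V)
    (w : KEdge V → ℝ) (hw : ∀ e, 0 < w e) (p : KEdge V → unitInterval) :
    (IsNormalized (expectedTree w p) ∧ Monotone (expectedTree w p) ∧
      IsSupermodular (expectedTree w p)) ∧
    ∀ Einit : Finset (KEdge V), (graphOn {e | e ∈ Einit ∧ 0 < p e}).Connected →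
      (IsNormalized (logExpectedTreeGain w p Einit) ∧
        Monotone (logExpectedTreeGain w p Einit) ∧
        IsSubmodular (logExpectedTreeGain w p Einit)) ∧
      IsLogSubmodular (fun E : Finset (KEdge V) => expectedTree w p (E ∪ Einit)) := by
  have : Nonempty V := Fintype.card_pos_iff.1 (by omega)
  set x : KEdge V → ℝ := fun e => w e * p e with hxdef
  have hx : ∀ e, 0 ≤ x e := fun e => mul_nonneg (hw e).le (p e).2.1
  have hξ : expectedTree w p = treeSum x := funext fun E => expectedTree_eq_treeSum w p E
  refine ⟨?_, fun E₀ hE₀ => ?_⟩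
  · rw [hξ]
    exact ⟨treeSum_empty hV x, treeSum_mono hx, isSupermodular_treeSum hx⟩
  have hx_pos : ∀ e, 0 < x e ↔ 0 < p e := by
    intro e
    rw [hxdef]
    exact (mul_pos_iff_of_pos_left (hw e)).trans unitInterval.coe_pos
  have hpos₀ : 0 < treeSum x E₀ := treeSum_pos_of_connected hx (by simpa only [hx_pos] using hE₀)
  have hpos : ∀ E, 0 < treeSum x (E ∪ E₀) := fun E =>
    hpos₀.trans_le (treeSum_mono hx Finset.subset_union_right)
  have hlog := isSubmodular_log_treeSum_union hx hpos
  have hgain : ∀ E, logExpectedTreeGain w p E₀ E =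
      Real.log (treeSum x (E ∪ E₀)) - Real.log (treeSum x E₀) := by
    intro E
    simp only [logExpectedTreeGain, logExpectedTree, hξ]
    -- Positivity rules out the default value `0` of the logarithm.
    rw [if_pos (hpos E), if_pos hpos₀]
  rw [hξ]
  refine ⟨⟨?_, ?_, ?_⟩, hpos, hlog⟩
  · rw [IsNormalized, hgain, Finset.empty_union, sub_self]
  · intro A B hAB
    rw [hgain, hgain]
    exact sub_le_sub_right (Real.log_le_log (hpos A)
      (treeSum_mono hx (Finset.union_subset_union_left hAB))) _
  · intro A B hAB s hs
    have := hlog A B hAB s hs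
    simp only [hgain] at this ⊢
    linarith
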